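/- Let $\mathcal{CF}_3$ be the cone of copositive $3\times 3$ matrices, i.e. of real symmetric $3\times 3$ matrices $A$ with $x^\top A x\ge 0$ for all entrywise nonnegative $x\in\mathbb{R}^3$, and let $\Delta_3=\{t\in\mathbb{R}^3_{\ge 0}: t_1+t_2+t_3=1\}$. For $(s_1,s_2,s_3,\lambda)\in\mathbb{R}^4_{\ge 0}$ and $t\in\Delta_3$ let $\Phi(s_1,s_2,s_3,\lambda,t)$ be the symmetric $3\times3$ matrix with diagonal entries $s_1^2,s_2^2,s_3^2$ and off-diagonal entries \[ a_{12}=(2s_1s_2+\lambda)\frac{t_3^2(1+t_1)(1+t_2)}{(1-t_1t_3)(1-t_2t_3)}-s_1s_2, \] \[ a_{13}=(2s_1s_3+\lambda)\frac{t_2^2(1+t_1)(1+t_3)}{(1-t_1t_2)(1-t_2t_3)}-s_1s_3, \] \[ a_{23}=(2s_2s_3+\lambda)\frac{t_1^2(1+t_2)(1+t_3)}{(1-t_1t_2)(1-t_1t_3)}-s_2s_3 \] (the denominators are positive on $\Delta_3$). Then $\Phi$ maps $\mathbb{R}^4_{\ge 0}\times\Delta_3$ into $\mathcal{CF}_3$,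 and $\Phi:\mathbb{R}^4_{\ge 0}\times\Delta_3\to\mathcal{CF}_3$ is surjective and almost injective: it is injective on the set of points of the domain with $s_1,s_2,s_3>0$, and the remaining set of points of the domain, where some $s_i=0$, has measure zero (with respect to the $6$-dimensional Hausdorff measure on the $6$-dimensional domain $\mathbb{R}^4_{\ge0}\times\Delta_3\subset\mathbb{R}^7$). -/

import Mathlib

open scoped Matrix

/-- The cone of copositive `n × n` real matrices: symmetric `A` with `xᵀ A x ≥ 0` for every
entrywise nonnegative vector `x`. -/
def copositiveCone (n : ℕ) : Set (Matrix (Fin n) (Fin n) ℝ) :=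
  {A | A.IsSymm ∧ ∀ x : Fin n → ℝ, (∀ i, 0 ≤ x i) → 0 ≤ x ⬝ᵥ (A *ᵥ x)}

/-- The parameter space, with points `(s, lam, t)`, where `s = (s₁, s₂, s₃)`, `lam` is the
parameter `λ`, and `t = (t₁, t₂, t₃)`. -/
abbrev CopParam : Type := (Fin 3 → ℝ) × ℝ × (Fin 3 → ℝ)

/-- The domain `ℝ⁴_{≥0} × Δ₃`, where `Δ₃` is the standard simplex
`t₁ + t₂ + t₃ = 1`, `t₁, t₂, t₃ ≥ 0`. -/
def copDomain : Set CopParam :=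
  {p | (∀ i, 0 ≤ p.1 i) ∧ 0 ≤ p.2.1 ∧ p.2.2 ∈ stdSimplex ℝ (Fin 3)}

/-- The rational function `c² (1 + a) (1 + b) / ((1 - a c) (1 - b c))`. -/
noncomputable def copWeight (a b c : ℝ) : ℝ :=
  c ^ 2 * (1 + a) * (1 + b) / ((1 - a * c) * (1 - b * c))

/-- The denominators `1 - tᵢ tⱼ` (`i ≠ j`) do not vanish on the standard simplex, so that no
division by zero occurs in `copWeight` on the domain. -/
theorem one_sub_mul_pos_of_mem_stdSimplex {t : Fin 3 → ℝ} (ht : t ∈ stdSimplex ℝ (Fin 3))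
    {i j : Fin 3} (hij : i ≠ j) : 0 < 1 - t i * t j := by
  obtain ⟨h0, h1⟩ := ht
  have hsum : t i + t j ≤ 1 := by
    rw [← h1, ← Finset.sum_pair hij]
    exact Finset.sum_le_sum_of_subset_of_nonneg (Finset.subset_univ _) (fun k _ _ => h0 k)
  nlinarith [h0 i, h0 j, sq_nonneg (t i - t j)]

/-- The parametrization `Φ(s₁, s₂, s₃, λ, t₁, t₂, t₃)`. -/
noncomputable def copParam (p : CopParam) : Matrix (Fin 3) (Fin 3) ℝ :=
  let s₁ := p.1 0
  let s₂ := p.1 1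
  let s₃ := p.1 2
  let lam := p.2.1
  let t₁ := p.2.2 0
  let t₂ := p.2.2 1
  let t₃ := p.2.2 2
  let a₁₂ := (2 * s₁ * s₂ + lam) * copWeight t₁ t₂ t₃ - s₁ * s₂
  let a₁₃ := (2 * s₁ * s₃ + lam) * copWeight t₁ t₃ t₂ - s₁ * s₃
  let a₂₃ := (2 * s₂ * s₃ + lam) * copWeight t₂ t₃ t₁ - s₂ * s₃
  !![s₁ ^ 2, a₁₂, a₁₃;
     a₁₂, s₂ ^ 2, a₂₃;
     a₁₃, a₂₃, s₃ ^ 2]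

/-- The exceptional set: the points of the domain at which some `sᵢ` is zero. -/
def copExceptional : Set CopParam :=
  {p | p ∈ copDomain ∧ ∃ i, p.1 i = 0}

/-!
The three weights `w₁, w₂, w₃` that occur in the parametrization are squared sines: for `t` in the
simplex `wᵢ = sin² αᵢ` with `tan αᵢ = √K tᵢ / (1 - tᵢ²)`, `K = (1 + t₁) (1 + t₂) (1 + t₃)`, and
`α₁ + α₂ + α₃ = π / 2`. In algebraic form the last relation is `w₁ + w₂ + w₃ + 2 √(w₁ w₂ w₃) = 1`,
that is, `sineSum = 1` (`sineSum_copWeight`). The weights map the simplex bijectively onto the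
nonnegative part of this surface. Given the tangents `Tᵢ`, the coordinates are
`tᵢ = g (m Tᵢ)`, where `g` inverts `x / (1 - x²)` and the scale `m` is determined by `∑ tᵢ = 1`;
then `m = 1 / √K` holds automatically (`sum_mul_div_one_sub_sq`, `exists_copWeight_eq`). Injectivity is
the same monotonicity in the scale (`eq_of_copWeight_eq`).

On the surface `sineSum = 1` the matrix with unit diagonal and off-diagonal entries `2 wᵢ - 1` is
positive semidefinite (`sineSum_form_nonneg`). Rescaling by the `sᵢ` and adding the nonnegative
entries `λ wᵢ` shows that the values of the parametrization are copositive. Conversely, copositivity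
of a matrix with unit diagonal and off-diagonal entries `2 wᵢ - 1`, `wᵢ ≥ 0`, forces `sineSum ≥ 1`
(`one_le_sineSum_of_form_nonneg`). For a copositive matrix with diagonal entries `sᵢ²`, `sᵢ > 0`,
the weights to be found are `wᵢ = (aⱼₖ + sⱼ sₖ) / (2 sⱼ sₖ + λ)`. Along these, `sineSum` is strictly
decreasing in `λ`, it is at least `1` at `λ = 0`, and it tends to `0`; hence there is exactly one
admissible `λ` (`exists_sineSum_div_eq_one`, `sineSum_div_unique`). If some `sᵢ` vanishes, existence
survives: either some quotient blows up as `λ → 0`, or the matrix is essentially of order two.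

The exceptional set lies in the union of three smooth images of a five-dimensional space, so its
Hausdorff dimension is at most `5`.
-/

/-! ### The weights as squared sines -/

/-- The function `x + y + z + 2 √(x y z)`. For angles `α, β, γ ∈ [0, π / 2]` with sum `π / 2`, it
takes the value `1` at `(sin² α, sin² β, sin² γ)`. -/
noncomputable def sineSum (x y z : ℝ) : ℝ := x + y + z + 2 * √(x * y * z)

theorem sineSum_sq {u v w : ℝ} (hu : 0 ≤ u) (hv : 0 ≤ v) (hw : 0 ≤ w) :
    sineSum (u ^ 2) (v ^ 2) (w ^ 2) = u ^ 2 + v ^ 2 + w ^ 2 + 2 * (u * v * w) := by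
  rw [sineSum, show u ^ 2 * v ^ 2 * w ^ 2 = (u * v * w) ^ 2 by ring,
    Real.sqrt_sq (by positivity)]

theorem sineSum_swap (x y z : ℝ) : sineSum y x z = sineSum x y z := by
  rw [sineSum, sineSum, mul_comm y x, add_comm y x]

theorem sineSum_rotate (x y z : ℝ) : sineSum y z x = sineSum x y z := by
  rw [sineSum, sineSum, show y * z * x = x * y * z by ring]; ring

theorem one_sub_mul_pos {a b : ℝ} (ha : 0 ≤ a) (hb : 0 ≤ b) (hab : a + b ≤ 1) :
    0 < 1 - a * b := by
  nlinarith [sq_nonneg (a - b)]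

theorem copWeight_nonneg {a b c : ℝ} (ha : 0 ≤ a) (hb : 0 ≤ b) (hc : 0 ≤ c)
    (h : a + b + c = 1) : 0 ≤ copWeight a b c := by
  have h1 := one_sub_mul_pos ha hc (by linarith)
  have h2 := one_sub_mul_pos hb hc (by linarith)
  unfold copWeight
  positivity

theorem one_sub_copWeight {a b c : ℝ} (ha : 0 ≤ a) (hb : 0 ≤ b) (hc : 0 ≤ c)
    (h : a + b + c = 1) :
    1 - copWeight a b c = (1 - c) ^ 2 * (1 + c) / ((1 - a * c) * (1 - b * c)) := by
  have h1 := one_sub_mul_pos ha hc (by linarith)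
  have h2 := one_sub_mul_pos hb hc (by linarith)
  unfold copWeight
  rw [one_sub_div (by positivity)]
  congr 1
  obtain rfl : a = 1 - b - c := by linarith
  ring

/-- If the weight is `sin² γ`, this says `tan² γ = K (c / (1 - c²))²` with
`K = (1 + a) (1 + b) (1 + c)`, free of denominators. The factor `K` is common to all weights. -/
theorem copWeight_mul_eq {a b c : ℝ} (ha : 0 ≤ a) (hb : 0 ≤ b) (hc : 0 ≤ c)
    (h : a + b + c = 1) :
    copWeight a b c * (1 - c ^ 2) ^ 2 =
      (1 - copWeight a b c) * ((1 + a) * (1 + b) * (1 + c)) * c ^ 2 := by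
  rw [one_sub_copWeight ha hb hc h, copWeight]
  ring

theorem sineSum_copWeight {a b c : ℝ} (ha : 0 ≤ a) (hb : 0 ≤ b) (hc : 0 ≤ c)
    (h : a + b + c = 1) :
    sineSum (copWeight b c a) (copWeight a c b) (copWeight a b c) = 1 := by
  have h1 := one_sub_mul_pos ha hc (by linarith)
  have h2 := one_sub_mul_pos hb hc (by linarith)
  have h3 := one_sub_mul_pos ha hb (by linarith)
  have hp : copWeight b c a * copWeight a c b * copWeight a b c =
      (a * b * c * ((1 + a) * (1 + b) * (1 + c)) /
        ((1 - a * b) * (1 - a * c) * (1 - b * c))) ^ 2 := by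
    unfold copWeight
    rw [mul_comm b a, mul_comm c a, mul_comm c b]
    field_simp
  rw [sineSum, hp, Real.sqrt_sq (by positivity)]
  unfold copWeight
  rw [mul_comm b a, mul_comm c a, mul_comm c b]
  field_simp
  obtain rfl : a = 1 - b - c := by linarith
  ring

theorem eq_one_of_copWeight_eq_one {a b c : ℝ} (ha : 0 ≤ a) (hb : 0 ≤ b) (hc : 0 ≤ c)
    (h : a + b + c = 1) (hw : copWeight a b c = 1) : c = 1 := by
  have h1 := copWeight_mul_eq ha hb hc h
  rw [hw, sub_self, zero_mul, zero_mul, one_mul, sq_eq_zero_iff] at h1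
  nlinarith

/-! ### Injectivity of the weights -/

/-- If `√K x / (1 - x²) = √L y / (1 - y²)` (stated squared and without denominators) and `K ≤ L`,
then `y ≤ x`, because `x / (1 - x²)` is increasing on `[0, 1)`. -/
theorem le_of_div_one_sub_sq_le {x y K L : ℝ} (hx : 0 ≤ x) (hy : 0 ≤ y)
    (hy1 : y < 1) (hK : 0 < K) (hKL : K ≤ L)
    (h : K * x ^ 2 * (1 - y ^ 2) ^ 2 = L * y ^ 2 * (1 - x ^ 2) ^ 2) : y ≤ x := by
  by_contra! hlt
  have h1 : x * (1 - y ^ 2) < y * (1 - x ^ 2) := by nlinarith [mul_nonneg hx hy]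
  have h2 : 0 ≤ x * (1 - y ^ 2) := mul_nonneg hx (by nlinarith)
  have h3 : (x * (1 - y ^ 2)) ^ 2 < (y * (1 - x ^ 2)) ^ 2 := by gcongr
  have h4 : K * (x * (1 - y ^ 2)) ^ 2 < L * (y * (1 - x ^ 2)) ^ 2 :=
    (mul_lt_mul_of_pos_left h3 hK).trans_le (by gcongr)
  nlinarith

theorem le_of_copWeight_eq {a b c a' b' c' : ℝ} (ha : 0 ≤ a) (hb : 0 ≤ b) (hc : 0 ≤ c)
    (h : a + b + c = 1) (ha' : 0 ≤ a') (hb' : 0 ≤ b') (hc' : 0 ≤ c') (h' : a' + b' + c' = 1)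
    (hK : (1 + a) * (1 + b) * (1 + c) ≤ (1 + a') * (1 + b') * (1 + c'))
    (hw : copWeight a b c = copWeight a' b' c') : c' ≤ c := by
  by_cases h1 : copWeight a b c = 1
  · rw [eq_one_of_copWeight_eq_one ha hb hc h h1]
    linarith
  have hne : 1 - copWeight a b c ≠ 0 := fun h0 => h1 (by linarith)
  have e := copWeight_mul_eq ha hb hc h
  have e' := copWeight_mul_eq ha' hb' hc' h'
  have hc1 : c ≠ 1 := by
    rintro rfl
    norm_num at e
    have : 0 < (1 + a) * (1 + b) := by positivity
    rcases e with e | e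
    · exact hne e
    · rcases e with e | e <;> linarith
  have hc1' : c' ≠ 1 := by
    rintro rfl
    rw [← hw] at e'
    norm_num at e'
    rcases e' with e | e
    · exact hne e
    · rcases e with e | e <;> linarith
  refine le_of_div_one_sub_sq_le hc hc'
    (lt_of_le_of_ne (by linarith) hc1') (by positivity) hK (mul_left_cancel₀ hne ?_)
  rw [← hw] at e'
  linear_combination -(1 - c' ^ 2) ^ 2 * e + (1 - c ^ 2) ^ 2 * e'

/-- Injectivity of the weights on the simplex. The point with the smaller value of
`(1 + a) (1 + b) (1 + c)` has the larger coordinates, and both coordinate sums are `1`. -/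
theorem eq_of_copWeight_eq {a b c a' b' c' : ℝ} (ha : 0 ≤ a) (hb : 0 ≤ b) (hc : 0 ≤ c)
    (h : a + b + c = 1) (ha' : 0 ≤ a') (hb' : 0 ≤ b') (hc' : 0 ≤ c') (h' : a' + b' + c' = 1)
    (h1 : copWeight b c a = copWeight b' c' a') (h2 : copWeight a c b = copWeight a' c' b')
    (h3 : copWeight a b c = copWeight a' b' c') : a = a' ∧ b = b' ∧ c = c' := by
  wlog hK : (1 + a) * (1 + b) * (1 + c) ≤ (1 + a') * (1 + b') * (1 + c') generalizing a b c a' b' c'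
  · obtain ⟨e1, e2, e3⟩ := this ha' hb' hc' h' ha hb hc h h1.symm h2.symm h3.symm
      (le_of_not_ge hK)
    exact ⟨e1.symm, e2.symm, e3.symm⟩
  have l3 := le_of_copWeight_eq ha hb hc h ha' hb' hc' h' hK h3
  have l2 := le_of_copWeight_eq ha hc hb (by linarith) ha' hc' hb' (by linarith)
    (by linarith) h2
  have l1 := le_of_copWeight_eq hb hc ha (by linarith) hb' hc' ha' (by linarith)
    (by linarith) h1
  exact ⟨by linarith, by linarith, by linarith⟩

/-! ### Surjectivity of the weights -/

/-- The inverse function of `x ↦ x / (1 - x²)`, from `[0, ∞)` onto `[0, 1)`; it equals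
`tan (θ / 2)` for `y = tan θ / 2`. -/
noncomputable def halfTan (y : ℝ) : ℝ := 2 * y / (1 + √(1 + 4 * y ^ 2))

theorem continuous_halfTan : Continuous halfTan := by
  unfold halfTan
  refine Continuous.div (by fun_prop) (by fun_prop) fun y => ?_
  positivity

theorem halfTan_nonneg {y : ℝ} (hy : 0 ≤ y) : 0 ≤ halfTan y := by
  unfold halfTan; positivity

theorem halfTan_eq (y : ℝ) : halfTan y = y * (1 - halfTan y ^ 2) := by
  have h : √(1 + 4 * y ^ 2) ^ 2 = 1 + 4 * y ^ 2 := Real.sq_sqrt (by positivity)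
  have h0 := Real.sqrt_nonneg (1 + 4 * y ^ 2)
  unfold halfTan
  generalize √(1 + 4 * y ^ 2) = r at *
  field_simp
  linear_combination (-y) * h

theorem halfTan_lt_one (y : ℝ) : halfTan y < 1 := by
  have h0 : |2 * y| ≤ √(1 + 4 * y ^ 2) := by
    rw [← Real.sqrt_sq_eq_abs]
    exact Real.sqrt_le_sqrt (by nlinarith)
  unfold halfTan
  rw [div_lt_one (by positivity)]
  linarith [le_abs_self (2 * y)]

theorem half_le_halfTan {y : ℝ} (hy : 1 ≤ y) : 1 / 2 ≤ halfTan y := by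
  have h := halfTan_eq y
  have h0 := halfTan_nonneg (zero_le_one.trans hy)
  by_contra! hlt
  nlinarith [mul_le_mul hy (show 3 / 4 ≤ 1 - halfTan y ^ 2 by nlinarith) (by norm_num)
    (zero_le_one.trans hy)]

/-- The scale `m` of the tangents for which the point lands on the simplex. -/
theorem exists_sum_halfTan_eq_one {x y z : ℝ} (hx : 0 < x) (hy : 0 < y) (hz : 0 ≤ z) :
    ∃ m, 0 < m ∧ halfTan (m * x) + halfTan (m * y) + halfTan (m * z) = 1 := by
  have hf : Continuous fun m => halfTan (m * x) + halfTan (m * y) + halfTan (m * z) := by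
    have := continuous_halfTan
    fun_prop
  have h0 : halfTan 0 = 0 := by simp [halfTan]
  have hM : 0 ≤ 1 / x + 1 / y := by positivity
  obtain ⟨m, hm, e⟩ := intermediate_value_Icc hM hf.continuousOn (show (1 : ℝ) ∈ _ from by
    refine ⟨by simp [h0], ?_⟩
    have h1 : 1 / 2 ≤ halfTan ((1 / x + 1 / y) * x) := half_le_halfTan (by
      rw [add_mul, one_div_mul_cancel hx.ne']
      exact le_add_of_nonneg_right (by positivity))
    have h2 : 1 / 2 ≤ halfTan ((1 / x + 1 / y) * y) := half_le_halfTan (by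
      rw [add_mul, one_div_mul_cancel hy.ne']
      exact le_add_of_nonneg_left (by positivity))
    have h3 : 0 ≤ halfTan ((1 / x + 1 / y) * z) := halfTan_nonneg (by positivity)
    linarith)
  refine ⟨m, lt_of_le_of_ne hm.1 ?_, e⟩
  rintro rfl
  simp [h0] at e

theorem copWeight_eq_of_tan {a b c m T : ℝ} (ha : 0 ≤ a) (hb : 0 ≤ b) (hc : 0 ≤ c) (hc1 : c < 1)
    (h : a + b + c = 1) (hK : m ^ 2 * ((1 + a) * (1 + b) * (1 + c)) = 1)
    (hT : c = m * T * (1 - c ^ 2)) : copWeight a b c = T ^ 2 / (1 + T ^ 2) := by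
  have e := copWeight_mul_eq ha hb hc h
  have hpos : 0 < 1 - c ^ 2 := by nlinarith
  rw [eq_div_iff (by positivity)]
  refine mul_left_cancel₀ (pow_pos hpos 2).ne' ?_
  have h2 : c ^ 2 = m ^ 2 * T ^ 2 * (1 - c ^ 2) ^ 2 := by
    linear_combination (c + m * T * (1 - c ^ 2)) * hT
  linear_combination e + (1 - copWeight a b c) * ((1 + a) * (1 + b) * (1 + c)) * h2
    + (1 - copWeight a b c) * T ^ 2 * (1 - c ^ 2) ^ 2 * hK

/-- On the simplex `∑ tan αᵢ tan αⱼ = 1` for `tan αᵢ = √K tᵢ / (1 - tᵢ²)`,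
`K = (1 + t₁) (1 + t₂) (1 + t₃)`. This forces the scale `m` found from the coordinate sum to be
`1 / √K`. -/
theorem sum_mul_div_one_sub_sq {a b c : ℝ} (h : a + b + c = 1) (ha : 0 ≤ a) (hb : 0 ≤ b)
    (hc : 0 ≤ c) (ha1 : a < 1) (hb1 : b < 1) (hc1 : c < 1) :
    (a / (1 - a ^ 2) * (b / (1 - b ^ 2)) + b / (1 - b ^ 2) * (c / (1 - c ^ 2)) +
      c / (1 - c ^ 2) * (a / (1 - a ^ 2))) * ((1 + a) * (1 + b) * (1 + c)) = 1 := by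
  have h1 : 1 - a ^ 2 ≠ 0 := by nlinarith
  have h2 : 1 - b ^ 2 ≠ 0 := by nlinarith
  have h3 : 1 - c ^ 2 ≠ 0 := by nlinarith
  field_simp
  obtain rfl : a = 1 - b - c := by linarith
  ring

/-- Surjectivity of the weights, in terms of the tangents `x, y, z` of the three angles. -/
theorem exists_copWeight_eq_of_tan {x y z : ℝ} (hx : 0 ≤ x) (hy : 0 ≤ y) (hz : 0 ≤ z)
    (h : x * y + y * z + z * x = 1) :
    ∃ a b c : ℝ, 0 ≤ a ∧ 0 ≤ b ∧ 0 ≤ c ∧ a + b + c = 1 ∧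
      copWeight b c a = x ^ 2 / (1 + x ^ 2) ∧ copWeight a c b = y ^ 2 / (1 + y ^ 2) ∧
      copWeight a b c = z ^ 2 / (1 + z ^ 2) := by
  have hm : ∃ m, 0 < m ∧ halfTan (m * x) + halfTan (m * y) + halfTan (m * z) = 1 := by
    rcases hx.eq_or_lt with rfl | hx
    · have hy' : 0 < y := lt_of_le_of_ne hy (by rintro rfl; simp at h)
      have hz' : 0 < z := lt_of_le_of_ne hz (by rintro rfl; simp at h)
      obtain ⟨m, hm, e⟩ := exists_sum_halfTan_eq_one hy' hz' le_rfl
      exact ⟨m, hm, by linarith⟩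
    rcases hy.eq_or_lt with rfl | hy
    · have hz' : 0 < z := lt_of_le_of_ne hz (by rintro rfl; simp at h)
      obtain ⟨m, hm, e⟩ := exists_sum_halfTan_eq_one hx hz' le_rfl
      exact ⟨m, hm, by linarith⟩
    exact exists_sum_halfTan_eq_one hx hy hz
  obtain ⟨m, hm, hs⟩ := hm
  have ea := halfTan_eq (m * x)
  have eb := halfTan_eq (m * y)
  have ec := halfTan_eq (m * z)
  have ha := halfTan_nonneg (mul_nonneg hm.le hx)
  have hb := halfTan_nonneg (mul_nonneg hm.le hy)
  have hc := halfTan_nonneg (mul_nonneg hm.le hz)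
  have ha1 := halfTan_lt_one (m * x)
  have hb1 := halfTan_lt_one (m * y)
  have hc1 := halfTan_lt_one (m * z)
  generalize halfTan (m * x) = a at *
  generalize halfTan (m * y) = b at *
  generalize halfTan (m * z) = c at *
  have hK : m ^ 2 * ((1 + a) * (1 + b) * (1 + c)) = 1 := by
    have key := sum_mul_div_one_sub_sq hs ha hb hc ha1 hb1 hc1
    rw [(div_eq_iff (show 1 - a ^ 2 ≠ 0 by nlinarith)).mpr ea,
      (div_eq_iff (show 1 - b ^ 2 ≠ 0 by nlinarith)).mpr eb,
      (div_eq_iff (show 1 - c ^ 2 ≠ 0 by nlinarith)).mpr ec] at key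
    linear_combination key - m ^ 2 * ((1 + a) * (1 + b) * (1 + c)) * h
  exact ⟨a, b, c, ha, hb, hc, hs,
    copWeight_eq_of_tan hb hc ha ha1 (by linarith) (by linarith) ea,
    copWeight_eq_of_tan ha hc hb hb1 (by linarith) (by linarith) eb,
    copWeight_eq_of_tan ha hb hc hc1 hs hK ec⟩

/-- The weights map the simplex onto the surface `sineSum = 1`: writing `wᵢ = sin² αᵢ`, either some
`αᵢ` is `π / 2`, and a vertex of the simplex is the preimage, or the tangents are finite and satisfy
`∑ tan αᵢ tan αⱼ = 1`. -/
theorem exists_copWeight_eq {w₁ w₂ w₃ : ℝ} (h₁ : 0 ≤ w₁) (h₂ : 0 ≤ w₂) (h₃ : 0 ≤ w₃)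
    (h : sineSum w₁ w₂ w₃ = 1) :
    ∃ a b c : ℝ, 0 ≤ a ∧ 0 ≤ b ∧ 0 ≤ c ∧ a + b + c = 1 ∧
      copWeight b c a = w₁ ∧ copWeight a c b = w₂ ∧ copWeight a b c = w₃ := by
  obtain ⟨u, hu, rfl⟩ : ∃ u, 0 ≤ u ∧ u ^ 2 = w₁ := ⟨_, Real.sqrt_nonneg _, Real.sq_sqrt h₁⟩
  obtain ⟨v, hv, rfl⟩ : ∃ u, 0 ≤ u ∧ u ^ 2 = w₂ := ⟨_, Real.sqrt_nonneg _, Real.sq_sqrt h₂⟩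
  obtain ⟨w, hw, rfl⟩ : ∃ u, 0 ≤ u ∧ u ^ 2 = w₃ := ⟨_, Real.sqrt_nonneg _, Real.sq_sqrt h₃⟩
  rw [sineSum_sq hu hv hw] at h
  have huvw : 0 ≤ u * v * w := by positivity
  have hzero {x y : ℝ} (hx : x ^ 2 + y ^ 2 ≤ 0) : x = 0 ∧ y = 0 :=
    ⟨by nlinarith [sq_nonneg y, sq_nonneg x], by nlinarith [sq_nonneg x, sq_nonneg y]⟩
  rcases (show u ^ 2 ≤ 1 by nlinarith).eq_or_lt with hu1 | hu1
  · obtain ⟨rfl, rfl⟩ := hzero (x := v) (y := w) (by linarith)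
    exact ⟨1, 0, 0, by norm_num, le_rfl, le_rfl, by norm_num, by simp [copWeight, hu1],
      by simp [copWeight], by simp [copWeight]⟩
  rcases (show v ^ 2 ≤ 1 by nlinarith).eq_or_lt with hv1 | hv1
  · obtain ⟨rfl, rfl⟩ := hzero (x := u) (y := w) (by linarith)
    exact ⟨0, 1, 0, le_rfl, by norm_num, le_rfl, by norm_num, by simp [copWeight],
      by simp [copWeight, hv1], by simp [copWeight]⟩
  rcases (show w ^ 2 ≤ 1 by nlinarith).eq_or_lt with hw1 | hw1
  · obtain ⟨rfl, rfl⟩ := hzero (x := u) (y := v) (by linarith)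
    exact ⟨0, 0, 1, le_rfl, le_rfl, by norm_num, by norm_num, by simp [copWeight],
      by simp [copWeight], by simp [copWeight, hw1]⟩
  have hcos {x : ℝ} (hx : x ^ 2 < 1) : ∃ P, 0 < P ∧ P ^ 2 = 1 - x ^ 2 :=
    ⟨√(1 - x ^ 2), Real.sqrt_pos.mpr (by linarith), Real.sq_sqrt (by linarith)⟩
  obtain ⟨P, hP, hP2⟩ := hcos hu1
  obtain ⟨Q, hQ, hQ2⟩ := hcos hv1
  obtain ⟨R, hR, hR2⟩ := hcos hw1
  have hmul {x y z X Y : ℝ} (hx : 0 ≤ x) (hy : 0 ≤ y) (hz : 0 ≤ z) (hX : 0 < X) (hY : 0 < Y)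
      (hX2 : X ^ 2 = 1 - x ^ 2) (hY2 : Y ^ 2 = 1 - y ^ 2)
      (e : x ^ 2 + y ^ 2 + z ^ 2 + 2 * (x * y * z) = 1) : X * Y = z + x * y := by
    refine (pow_left_inj₀ (by positivity) (by positivity) two_ne_zero).mp ?_
    rw [mul_pow, hX2, hY2]
    linear_combination -e
  have hPQ := hmul hu hv hw hP hQ hP2 hQ2 h
  have hPR := hmul hu hw hv hP hR hP2 hR2 (by linarith)
  have hQR := hmul hv hw hu hQ hR hQ2 hR2 (by linarith)
  -- `sin (α + β) = cos γ`
  have hsin : v * P + u * Q = R := by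
    refine mul_right_cancel₀ hR.ne' ?_
    linear_combination v * hPR + u * hQR - hR2 + h
  have hcosz : u / P * (v / Q) + v / Q * (w / R) + w / R * (u / P) = 1 := by
    field_simp
    linear_combination w * hsin - R * hPQ
  obtain ⟨a, b, c, ha, hb, hc, hs, e₁, e₂, e₃⟩ := exists_copWeight_eq_of_tan
    (div_nonneg hu hP.le) (div_nonneg hv hQ.le) (div_nonneg hw hR.le) hcosz
  have hval {x X : ℝ} (hX : 0 < X) (hX2 : X ^ 2 = 1 - x ^ 2) :
      (x / X) ^ 2 / (1 + (x / X) ^ 2) = x ^ 2 := by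
    have : X ^ 2 + x ^ 2 = 1 := by linarith
    field_simp
    rw [this]; ring
  exact ⟨a, b, c, ha, hb, hc, hs, e₁.trans (hval hP hP2), e₂.trans (hval hQ hQ2),
    e₃.trans (hval hR hR2)⟩

/-! ### The forms with unit diagonal -/

/-- On the surface `sineSum = 1` the symmetric matrix with unit diagonal and off-diagonal entries
`2 wᵢ - 1` is singular, which is `hdet` below, and positive semidefinite. -/
theorem sineSum_form_nonneg {w₁ w₂ w₃ : ℝ} (h₁ : 0 ≤ w₁) (h₂ : 0 ≤ w₂) (h₃ : 0 ≤ w₃)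
    (h : sineSum w₁ w₂ w₃ = 1) (x y z : ℝ) :
    0 ≤ x ^ 2 + y ^ 2 + z ^ 2 + 2 * (2 * w₃ - 1) * (x * y) + 2 * (2 * w₂ - 1) * (x * z) +
      2 * (2 * w₁ - 1) * (y * z) := by
  have hp : √(w₁ * w₂ * w₃) ^ 2 = w₁ * w₂ * w₃ := Real.sq_sqrt (by positivity)
  have hr := Real.sqrt_nonneg (w₁ * w₂ * w₃)
  unfold sineSum at h
  have hdet : (1 - w₁ - w₂ - w₃) ^ 2 = 4 * (w₁ * w₂ * w₃) := by
    rw [← hp, show 1 - w₁ - w₂ - w₃ = 2 * √(w₁ * w₂ * w₃) by linarith]; ring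
  have hA : 0 ≤ 4 * w₃ * (1 - w₃) := mul_nonneg (by positivity) (by linarith)
  have hC : 0 ≤ 4 * w₂ * (1 - w₂) := mul_nonneg (by positivity) (by linarith)
  have hB : ((2 * w₁ - 1) - (2 * w₂ - 1) * (2 * w₃ - 1)) ^ 2 =
      (4 * w₃ * (1 - w₃)) * (4 * w₂ * (1 - w₂)) := by
    linear_combination 4 * hdet
  have hform : x ^ 2 + y ^ 2 + z ^ 2 + 2 * (2 * w₃ - 1) * (x * y) + 2 * (2 * w₂ - 1) * (x * z) +
      2 * (2 * w₁ - 1) * (y * z) = (x + (2 * w₃ - 1) * y + (2 * w₂ - 1) * z) ^ 2 +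
      ((4 * w₃ * (1 - w₃)) * y ^ 2 +
        2 * ((2 * w₁ - 1) - (2 * w₂ - 1) * (2 * w₃ - 1)) * (y * z) +
        (4 * w₂ * (1 - w₂)) * z ^ 2) := by ring
  rw [hform]
  refine add_nonneg (sq_nonneg _) ?_
  generalize 4 * w₃ * (1 - w₃) = A at *
  generalize 4 * w₂ * (1 - w₂) = C at *
  generalize (2 * w₁ - 1) - (2 * w₂ - 1) * (2 * w₃ - 1) = B at *
  rcases hA.eq_or_lt with rfl | hA
  · have : B = 0 := by simpa using hB
    subst this
    nlinarith [mul_nonneg hC (sq_nonneg z)]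
  · refine nonneg_of_mul_nonneg_right (a := A) ?_ hA
    nlinarith [sq_nonneg (A * y + B * z)]

/-- Below the surface `sineSum = 1` the matrix with unit diagonal and off-diagonal entries
`2 wᵢ - 1 = -cos 2αᵢ` is not copositive. With `u = sin α`, `v = sin β` the test vector is half of
`(sin 2α, sin 2β, sin (2α + 2β))`, the kernel vector of the singular matrix that is obtained by
raising `w` until the three angles sum to `π / 2`. -/
theorem exists_form_neg {u v w : ℝ} (hu : 0 ≤ u) (hv : 0 ≤ v) (hw : 0 ≤ w)
    (h : u ^ 2 + v ^ 2 + w ^ 2 + 2 * (u * v * w) < 1) :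
    ∃ x y z : ℝ, 0 ≤ x ∧ 0 ≤ y ∧ 0 ≤ z ∧
      x ^ 2 + y ^ 2 + z ^ 2 + 2 * (2 * w ^ 2 - 1) * (x * y) + 2 * (2 * v ^ 2 - 1) * (x * z) +
        2 * (2 * u ^ 2 - 1) * (y * z) < 0 := by
  rcases hu.eq_or_lt with rfl | hu
  · have hpos : 0 < 1 - v ^ 2 - w ^ 2 := by linarith
    -- The general test vector degenerates for `u = 0`; at `(x, 1, 1)` the form is
    -- `x² - 4 x (1 - v² - w²)`.
    exact ⟨2 * (1 - v ^ 2 - w ^ 2), 1, 1, by positivity, zero_le_one, zero_le_one, by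
      nlinarith [mul_pos hpos hpos]⟩
  rcases hv.eq_or_lt with rfl | hv
  · have hpos : 0 < 1 - u ^ 2 - w ^ 2 := by linarith
    exact ⟨1, 2 * (1 - u ^ 2 - w ^ 2), 1, zero_le_one, by positivity, zero_le_one, by
      nlinarith [mul_pos hpos hpos]⟩
  have huvw : 0 ≤ u * v * w := by positivity
  have hP0 : 0 < 1 - u ^ 2 := by nlinarith
  have hQ0 : 0 < 1 - v ^ 2 := by nlinarith
  obtain ⟨P, hP, hP2⟩ : ∃ P, 0 < P ∧ P ^ 2 = 1 - u ^ 2 :=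
    ⟨_, Real.sqrt_pos.mpr hP0, Real.sq_sqrt hP0.le⟩
  obtain ⟨Q, hQ, hQ2⟩ : ∃ Q, 0 < Q ∧ Q ^ 2 = 1 - v ^ 2 :=
    ⟨_, Real.sqrt_pos.mpr hQ0, Real.sq_sqrt hQ0.le⟩
  -- `P` and `Q` are the cosines, so that this says `w < cos (α + β)`.
  have hlt : w + u * v < P * Q := by
    refine lt_of_pow_lt_pow_left₀ 2 (by positivity) ?_
    rw [mul_pow, hP2, hQ2]
    nlinarith
  have hw2 : w ^ 2 < (P * Q - u * v) ^ 2 := by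
    have : w < P * Q - u * v := by linarith
    gcongr
  have hD : 0 ≤ P * Q - u * v := by linarith
  refine ⟨u * P, v * Q, (u * Q + v * P) * (P * Q - u * v), by positivity, by positivity,
    by positivity, ?_⟩
  have key : (u * P) ^ 2 + (v * Q) ^ 2 + ((u * Q + v * P) * (P * Q - u * v)) ^ 2 +
      2 * (2 * w ^ 2 - 1) * (u * P * (v * Q)) +
      2 * (2 * v ^ 2 - 1) * (u * P * ((u * Q + v * P) * (P * Q - u * v))) +
      2 * (2 * u ^ 2 - 1) * (v * Q * ((u * Q + v * P) * (P * Q - u * v))) =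
      4 * (u * P * (v * Q)) * (w ^ 2 - (P * Q - u * v) ^ 2) := by
    have hz : (u * Q + v * P) * (P * Q - u * v) =
        (1 - 2 * v ^ 2) * (u * P) + (1 - 2 * u ^ 2) * (v * Q) := by
      linear_combination (v * Q) * hP2 + (u * P) * hQ2
    have hsq : (P * Q - u * v) ^ 2 = (1 - u ^ 2) * (1 - v ^ 2) + u ^ 2 * v ^ 2
        - 2 * (P * Q * (u * v)) := by
      rw [← hP2, ← hQ2]; ring
    rw [hz, hsq]
    linear_combination (-4 * u ^ 2 * v ^ 2 * Q ^ 2) * hP2 - (4 * u ^ 2 * v ^ 2 * P ^ 2) * hQ2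
  rw [key]
  exact mul_neg_of_pos_of_neg (by positivity) (by linarith)

theorem one_le_sineSum_of_form_nonneg {w₁ w₂ w₃ : ℝ} (h₁ : 0 ≤ w₁) (h₂ : 0 ≤ w₂) (h₃ : 0 ≤ w₃)
    (h : ∀ x y z : ℝ, 0 ≤ x → 0 ≤ y → 0 ≤ z →
      0 ≤ x ^ 2 + y ^ 2 + z ^ 2 + 2 * (2 * w₃ - 1) * (x * y) + 2 * (2 * w₂ - 1) * (x * z) +
        2 * (2 * w₁ - 1) * (y * z)) : 1 ≤ sineSum w₁ w₂ w₃ := by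
  by_contra! hlt
  rw [← Real.sq_sqrt h₁, ← Real.sq_sqrt h₂, ← Real.sq_sqrt h₃,
    sineSum_sq (by positivity) (by positivity) (by positivity)] at hlt
  obtain ⟨x, y, z, hx, hy, hz, hneg⟩ := exists_form_neg (by positivity) (by positivity)
    (by positivity) hlt
  rw [Real.sq_sqrt h₁, Real.sq_sqrt h₂, Real.sq_sqrt h₃] at hneg
  exact (h x y z hx hy hz).not_gt hneg

/-! ### Solving for the parameter `λ` -/

/-- As `l` grows all the `wᵢ = bᵢ / (qᵢ + l)` shrink, strictly unless `bᵢ = 0`, so `sineSum = 1`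
holds for at most one `l`. -/
theorem sineSum_div_unique {b₁ b₂ b₃ q₁ q₂ q₃ l m w₁ w₂ w₃ v₁ v₂ v₃ : ℝ}
    (hq₁ : 0 < q₁) (hq₂ : 0 < q₂) (hq₃ : 0 < q₃) (hl : 0 ≤ l) (hm : 0 ≤ m)
    (hw₁ : 0 ≤ w₁) (hw₂ : 0 ≤ w₂) (hw₃ : 0 ≤ w₃) (hv₁ : 0 ≤ v₁) (hv₂ : 0 ≤ v₂) (hv₃ : 0 ≤ v₃)
    (hw : sineSum w₁ w₂ w₃ = 1) (hv : sineSum v₁ v₂ v₃ = 1)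
    (e₁ : (q₁ + l) * w₁ = b₁) (e₂ : (q₂ + l) * w₂ = b₂) (e₃ : (q₃ + l) * w₃ = b₃)
    (f₁ : (q₁ + m) * v₁ = b₁) (f₂ : (q₂ + m) * v₂ = b₂) (f₃ : (q₃ + m) * v₃ = b₃) : l = m := by
  wlog hlm : l < m generalizing l m w₁ w₂ w₃ v₁ v₂ v₃
  · rcases (not_lt.mp hlm).eq_or_lt with h | h
    · exact h.symm
    · exact (this hm hl hv₁ hv₂ hv₃ hw₁ hw₂ hw₃ hv hw f₁ f₂ f₃ e₁ e₂ e₃ h).symm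
  exfalso
  have hle {q x y : ℝ} (hq : 0 < q) (hy : 0 ≤ y) (e : (q + l) * x = (q + m) * y) : y ≤ x := by
    have : 0 < q + l := by linarith
    nlinarith
  have l₁ := hle hq₁ hv₁ (e₁.trans f₁.symm)
  have l₂ := hle hq₂ hv₂ (e₂.trans f₂.symm)
  have l₃ := hle hq₃ hv₃ (e₃.trans f₃.symm)
  have hs : √(v₁ * v₂ * v₃) ≤ √(w₁ * w₂ * w₃) := Real.sqrt_le_sqrt (by gcongr)
  unfold sineSum at hw hv
  have hz {q x y : ℝ} (e : (q + l) * x = (q + m) * y) (hxy : x = y) : x = 0 := by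
    subst hxy
    have : (m - l) * x = 0 := by linarith
    exact (mul_eq_zero.mp this).resolve_left (by linarith)
  have z₁ := hz (e₁.trans f₁.symm) (by linarith)
  have z₂ := hz (e₂.trans f₂.symm) (by linarith)
  have z₃ := hz (e₃.trans f₃.symm) (by linarith)
  simp [z₁, z₂, z₃] at hw

/-- The intermediate value theorem in `l`: `sineSum` is at most `1` once all three quotients are at
most `1 / 4`. -/
theorem exists_sineSum_div_eq_one {b₁ b₂ b₃ q₁ q₂ q₃ l : ℝ} (hb₁ : 0 ≤ b₁) (hb₂ : 0 ≤ b₂)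
    (hb₃ : 0 ≤ b₃) (hq₁ : 0 < q₁ + l) (hq₂ : 0 < q₂ + l) (hq₃ : 0 < q₃ + l)
    (h : 1 ≤ sineSum (b₁ / (q₁ + l)) (b₂ / (q₂ + l)) (b₃ / (q₃ + l))) :
    ∃ m, l ≤ m ∧ sineSum (b₁ / (q₁ + m)) (b₂ / (q₂ + m)) (b₃ / (q₃ + m)) = 1 := by
  have hL : l ≤ l + 4 * (b₁ + b₂ + b₃) := by linarith
  have hsmall {q b : ℝ} (hq : 0 < q + l) (hb : 0 ≤ b) (hB : b ≤ b₁ + b₂ + b₃) :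
      0 ≤ b / (q + (l + 4 * (b₁ + b₂ + b₃))) ∧ b / (q + (l + 4 * (b₁ + b₂ + b₃))) ≤ 1 / 4 := by
    have : 0 < q + (l + 4 * (b₁ + b₂ + b₃)) := by linarith
    exact ⟨by positivity, by rw [div_le_iff₀ this]; linarith⟩
  obtain ⟨m, hm, e⟩ := intermediate_value_Icc' hL
    (f := fun m => sineSum (b₁ / (q₁ + m)) (b₂ / (q₂ + m)) (b₃ / (q₃ + m))) (by
      have hne {q : ℝ} (hq : 0 < q + l) : ∀ m ∈ Set.Icc l (l + 4 * (b₁ + b₂ + b₃)), q + m ≠ 0 :=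
        fun m hm => by linarith [hm.1]
      have c₁ := hne hq₁
      have c₂ := hne hq₂
      have c₃ := hne hq₃
      unfold sineSum
      fun_prop (disch := assumption))
    (show (1 : ℝ) ∈ _ from ⟨by
      obtain ⟨p₁, s₁⟩ := hsmall hq₁ hb₁ (by linarith)
      obtain ⟨p₂, s₂⟩ := hsmall hq₂ hb₂ (by linarith)
      obtain ⟨p₃, s₃⟩ := hsmall hq₃ hb₃ (by linarith)
      have hs : √(b₁ / (q₁ + (l + 4 * (b₁ + b₂ + b₃))) * (b₂ / (q₂ + (l + 4 * (b₁ + b₂ + b₃)))) *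
          (b₃ / (q₃ + (l + 4 * (b₁ + b₂ + b₃))))) ≤ 1 / 8 := by
        rw [Real.sqrt_le_left (by norm_num)]
        calc _ ≤ (1 / 4 : ℝ) * (1 / 4) * (1 / 4) := by gcongr
          _ = _ := by norm_num
      simp only [sineSum]
      linarith, h⟩)
  exact ⟨m, hm.1, e⟩

/-- The values `bᵢ` can be written as `(qᵢ + l) wᵢ` with `l ≥ 0` and `w` a nonnegative point of the
surface `sineSum = 1`. With `qᵢ = 2 sⱼ sₖ` and `bᵢ = aⱼₖ + sⱼ sₖ` this is solvability of the
equations for `λ` and the weights in the parametrization. -/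
def SineSolvable (b₁ b₂ b₃ q₁ q₂ q₃ : ℝ) : Prop :=
  ∃ l w₁ w₂ w₃ : ℝ, 0 ≤ l ∧ 0 ≤ w₁ ∧ 0 ≤ w₂ ∧ 0 ≤ w₃ ∧ sineSum w₁ w₂ w₃ = 1 ∧
    (q₁ + l) * w₁ = b₁ ∧ (q₂ + l) * w₂ = b₂ ∧ (q₃ + l) * w₃ = b₃

theorem SineSolvable.swap {b₁ b₂ b₃ q₁ q₂ q₃ : ℝ} :
    SineSolvable b₂ b₁ b₃ q₂ q₁ q₃ → SineSolvable b₁ b₂ b₃ q₁ q₂ q₃ := by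
  rintro ⟨l, w₁, w₂, w₃, hl, h₁, h₂, h₃, h, e₁, e₂, e₃⟩
  exact ⟨l, w₂, w₁, w₃, hl, h₂, h₁, h₃, (sineSum_swap _ _ _).trans h, e₂, e₁, e₃⟩

theorem SineSolvable.rotate {b₁ b₂ b₃ q₁ q₂ q₃ : ℝ} :
    SineSolvable b₃ b₁ b₂ q₃ q₁ q₂ → SineSolvable b₁ b₂ b₃ q₁ q₂ q₃ := by
  rintro ⟨l, w₃, w₁, w₂, hl, h₃, h₁, h₂, h, e₃, e₁, e₂⟩
  exact ⟨l, w₁, w₂, w₃, hl, h₁, h₂, h₃, (sineSum_rotate _ _ _).trans h, e₁, e₂, e₃⟩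

theorem SineSolvable.of_one_le {b₁ b₂ b₃ q₁ q₂ q₃ l : ℝ} (hb₁ : 0 ≤ b₁) (hb₂ : 0 ≤ b₂)
    (hb₃ : 0 ≤ b₃) (hl : 0 ≤ l) (hq₁ : 0 < q₁ + l) (hq₂ : 0 < q₂ + l) (hq₃ : 0 < q₃ + l)
    (h : 1 ≤ sineSum (b₁ / (q₁ + l)) (b₂ / (q₂ + l)) (b₃ / (q₃ + l))) :
    SineSolvable b₁ b₂ b₃ q₁ q₂ q₃ := by
  obtain ⟨m, hm, e⟩ := exists_sineSum_div_eq_one hb₁ hb₂ hb₃ hq₁ hq₂ hq₃ h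
  have p₁ : 0 < q₁ + m := by linarith
  have p₂ : 0 < q₂ + m := by linarith
  have p₃ : 0 < q₃ + m := by linarith
  exact ⟨m, _, _, _, hl.trans hm, by positivity, by positivity, by positivity, e,
    mul_div_cancel₀ _ p₁.ne', mul_div_cancel₀ _ p₂.ne', mul_div_cancel₀ _ p₃.ne'⟩

/-- If `q₁ = 0 < b₁`, then `l = b₁` gives `w₁ = 1`, so that `sineSum ≥ 1` at this `l`. -/
theorem SineSolvable.of_zero_of_pos {b₁ b₂ b₃ q₂ q₃ : ℝ} (hb₁ : 0 < b₁) (hb₂ : 0 ≤ b₂)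
    (hb₃ : 0 ≤ b₃) (hq₂ : 0 ≤ q₂) (hq₃ : 0 ≤ q₃) : SineSolvable b₁ b₂ b₃ 0 q₂ q₃ := by
  refine .of_one_le hb₁.le hb₂ hb₃ hb₁.le (by linarith) (by linarith) (by linarith) ?_
  rw [zero_add, div_self hb₁.ne', sineSum]
  have : 0 ≤ b₂ / (q₂ + b₁) := by positivity
  have : 0 ≤ b₃ / (q₃ + b₁) := by positivity
  have := Real.sqrt_nonneg (1 * (b₂ / (q₂ + b₁)) * (b₃ / (q₃ + b₁)))
  linarith

/-- When two of the `b`'s and the matching `q`'s vanish: for `b ≥ q` the point `w = (1, 0, 0)` works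
with `l = b - q`, and for `b ≤ q` one takes `l = 0`, which leaves the equations for `w₂` and `w₃`
void. -/
theorem SineSolvable.of_zero_zero {b q : ℝ} (hb : 0 ≤ b) (hq : 0 ≤ q) :
    SineSolvable b 0 0 q 0 0 := by
  rcases le_total q b with h | h
  · exact ⟨b - q, 1, 0, 0, by linarith, zero_le_one, le_rfl, le_rfl, by simp [sineSum],
      by ring, by ring, by ring⟩
  · have h1 : b / q ≤ 1 := div_le_one_of_le₀ h hq
    refine ⟨0, b / q, 1 - b / q, 0, le_rfl, by positivity, by linarith, le_rfl,
      by simp [sineSum], ?_, by ring, by ring⟩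
    rcases hq.eq_or_lt with rfl | hq
    · simp [le_antisymm h hb]
    · field_simp; ring

/-! ### Copositive matrices of order three -/

theorem add_mul_nonneg_of_form_nonneg {a s r : ℝ} (hs : 0 ≤ s) (hr : 0 ≤ r)
    (h : ∀ x y : ℝ, 0 ≤ x → 0 ≤ y → 0 ≤ s ^ 2 * x ^ 2 + r ^ 2 * y ^ 2 + 2 * a * (x * y)) :
    0 ≤ a + s * r := by
  by_contra! hlt
  rcases hs.eq_or_lt with rfl | hs
  -- If `s = 0`, the form is `r² y² + 2 a x y`; with `y = -a > 0` it is negative for large `x`.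
  · have := h (r ^ 2 + 1) (-a) (by positivity) (by linarith)
    nlinarith [mul_nonneg (sq_nonneg a) (sq_nonneg r)]
  rcases hr.eq_or_lt with rfl | hr
  · have := h (-a) (s ^ 2 + 1) (by linarith) (by positivity)
    nlinarith [mul_nonneg (sq_nonneg a) (sq_nonneg s)]
  · have := h r s hr.le hs.le
    nlinarith [mul_pos hs hr]

/-- A copositive form with diagonal `sᵢ²` gives a solvable system. If all `sᵢ > 0`, rescaling to
unit diagonal shows that `sineSum ≥ 1` at `l = 0`; if some `sᵢ` vanishes, so do two of the `q`'s. -/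
theorem sineSolvable_of_form_nonneg {s₁ s₂ s₃ a₁₂ a₁₃ a₂₃ : ℝ} (h₁ : 0 ≤ s₁) (h₂ : 0 ≤ s₂)
    (h₃ : 0 ≤ s₃)
    (h : ∀ x y z : ℝ, 0 ≤ x → 0 ≤ y → 0 ≤ z → 0 ≤ s₁ ^ 2 * x ^ 2 + s₂ ^ 2 * y ^ 2 +
      s₃ ^ 2 * z ^ 2 + 2 * a₁₂ * (x * y) + 2 * a₁₃ * (x * z) + 2 * a₂₃ * (y * z)) :
    SineSolvable (a₂₃ + s₂ * s₃) (a₁₃ + s₁ * s₃) (a₁₂ + s₁ * s₂)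
      (2 * s₂ * s₃) (2 * s₁ * s₃) (2 * s₁ * s₂) := by
  have b₃ : 0 ≤ a₁₂ + s₁ * s₂ := add_mul_nonneg_of_form_nonneg h₁ h₂ fun x y hx hy => by
    linarith [h x y 0 hx hy le_rfl]
  have b₂ : 0 ≤ a₁₃ + s₁ * s₃ := add_mul_nonneg_of_form_nonneg h₁ h₃ fun x z hx hz => by
    linarith [h x 0 z hx le_rfl hz]
  have b₁ : 0 ≤ a₂₃ + s₂ * s₃ := add_mul_nonneg_of_form_nonneg h₂ h₃ fun y z hy hz => by
    linarith [h 0 y z le_rfl hy hz]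
  have q₁ : 0 ≤ 2 * s₂ * s₃ := by positivity
  have q₂ : 0 ≤ 2 * s₁ * s₃ := by positivity
  have q₃ : 0 ≤ 2 * s₁ * s₂ := by positivity
  rcases h₁.eq_or_lt with rfl | p₁
  · simp only [zero_mul, mul_zero, add_zero] at *
    rcases b₂.eq_or_lt with e₂ | p₂
    · rcases b₃.eq_or_lt with e₃ | p₃
      · rw [← e₂, ← e₃]
        exact .of_zero_zero b₁ q₁
      · exact .rotate (.of_zero_of_pos p₃ b₁ b₂ q₁ le_rfl)
    · exact .swap (.of_zero_of_pos p₂ b₁ b₃ q₁ le_rfl)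
  rcases h₂.eq_or_lt with rfl | p₂
  · simp only [zero_mul, mul_zero, add_zero] at *
    rcases b₁.eq_or_lt with e₁ | p₁
    · rcases b₃.eq_or_lt with e₃ | p₃
      · rw [← e₁, ← e₃]
        exact .swap (.of_zero_zero b₂ q₂)
      · exact .rotate (.of_zero_of_pos p₃ b₁ b₂ le_rfl q₂)
    · exact .of_zero_of_pos p₁ b₂ b₃ q₂ le_rfl
  rcases h₃.eq_or_lt with rfl | p₃
  · simp only [mul_zero, add_zero] at *
    rcases b₁.eq_or_lt with e₁ | p₁
    · rcases b₂.eq_or_lt with e₂ | p₂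
      · rw [← e₁, ← e₂]
        exact .rotate (.of_zero_zero b₃ q₃)
      · exact .swap (.of_zero_of_pos p₂ b₁ b₃ le_rfl q₃)
    · exact .of_zero_of_pos p₁ b₂ b₃ le_rfl q₃
  refine .of_one_le b₁ b₂ b₃ le_rfl (by positivity) (by positivity) (by positivity) ?_
  refine one_le_sineSum_of_form_nonneg (by positivity) (by positivity) (by positivity)
    fun x y z hx hy hz => ?_
  have := h (x / s₁) (y / s₂) (z / s₃) (by positivity) (by positivity) (by positivity)
  refine this.trans_eq ?_
  field_simp
  ring

theorem dotProduct_mulVec_fin_three {A : Matrix (Fin 3) (Fin 3) ℝ} (hA : A.IsSymm)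
    (x : Fin 3 → ℝ) : x ⬝ᵥ (A *ᵥ x) = A 0 0 * x 0 ^ 2 + A 1 1 * x 1 ^ 2 + A 2 2 * x 2 ^ 2 +
      2 * A 0 1 * (x 0 * x 1) + 2 * A 0 2 * (x 0 * x 2) + 2 * A 1 2 * (x 1 * x 2) := by
  simp only [dotProduct, Matrix.mulVec, Fin.sum_univ_three]
  rw [hA.apply 0 1, hA.apply 0 2, hA.apply 1 2]
  ring

/-! ### The parametrization -/

theorem isSymm_copParam (p : CopParam) : (copParam p).IsSymm := by
  ext i j
  fin_cases i <;> fin_cases j <;> rfl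

theorem mapsTo_copParam : Set.MapsTo copParam copDomain (copositiveCone 3) := by
  rintro ⟨s, l, t⟩ ⟨hs, hl, ht, hsum⟩
  refine ⟨isSymm_copParam _, fun x hx => ?_⟩
  rw [dotProduct_mulVec_fin_three (isSymm_copParam _)]
  simp only [copParam, Matrix.of_apply, Matrix.cons_val]
  rw [Fin.sum_univ_three] at hsum
  simp only at hs hl ht hsum
  have n₃ := copWeight_nonneg (ht 0) (ht 1) (ht 2) hsum
  have n₂ := copWeight_nonneg (ht 0) (ht 2) (ht 1) (by linarith)
  have n₁ := copWeight_nonneg (ht 1) (ht 2) (ht 0) (by linarith)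
  have hform := sineSum_form_nonneg n₁ n₂ n₃ (sineSum_copWeight (ht 0) (ht 1) (ht 2) hsum)
    (s 0 * x 0) (s 1 * x 1) (s 2 * x 2)
  have m₃ := mul_nonneg (mul_nonneg hl n₃) (mul_nonneg (hx 0) (hx 1))
  have m₂ := mul_nonneg (mul_nonneg hl n₂) (mul_nonneg (hx 0) (hx 2))
  have m₁ := mul_nonneg (mul_nonneg hl n₁) (mul_nonneg (hx 1) (hx 2))
  linarith

theorem surjOn_copParam : Set.SurjOn copParam copDomain (copositiveCone 3) := by
  rintro A ⟨hA, hcop⟩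
  have hQ (x y z : ℝ) (hx : 0 ≤ x) (hy : 0 ≤ y) (hz : 0 ≤ z) := by
    have := hcop ![x, y, z] (by simp [Fin.forall_fin_succ, hx, hy, hz])
    rw [dotProduct_mulVec_fin_three hA] at this
    simpa only [Matrix.cons_val] using this
  have hd (i : Fin 3) : √(A i i) ^ 2 = A i i := Real.sq_sqrt (by
    have h0 := hQ 1 0 0 zero_le_one le_rfl le_rfl
    have h1 := hQ 0 1 0 le_rfl zero_le_one le_rfl
    have h2 := hQ 0 0 1 le_rfl le_rfl zero_le_one
    norm_num at h0 h1 h2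
    fin_cases i <;> assumption)
  have hform (x y z : ℝ) (hx : 0 ≤ x) (hy : 0 ≤ y) (hz : 0 ≤ z) := by
    have := hQ x y z hx hy hz
    rwa [← hd 0, ← hd 1, ← hd 2] at this
  obtain ⟨l, w₁, w₂, w₃, hl, n₁, n₂, n₃, hw, e₁, e₂, e₃⟩ := sineSolvable_of_form_nonneg
    (Real.sqrt_nonneg _) (Real.sqrt_nonneg _) (Real.sqrt_nonneg _) hform
  obtain ⟨a, b, c, ha, hb, hc, hs, rfl, rfl, rfl⟩ := exists_copWeight_eq n₁ n₂ n₃ hw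
  refine ⟨(fun i => √(A i i), l, ![a, b, c]), ⟨fun i => Real.sqrt_nonneg _, hl, ?_, ?_⟩, ?_⟩
  · simp [Fin.forall_fin_succ, ha, hb, hc]
  · simpa [Fin.sum_univ_three] using hs
  · have s₁ := hA.apply 0 1
    have s₂ := hA.apply 0 2
    have s₃ := hA.apply 1 2
    ext i j
    fin_cases i <;> fin_cases j <;>
      simp only [copParam, Matrix.of_apply, Matrix.cons_val, Fin.mk_one, Fin.zero_eta,
        Fin.reduceFinMk, Fin.isValue, hd] <;> linarith

theorem injOn_copParam : Set.InjOn copParam (copDomain \ copExceptional) := by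
  rintro ⟨s, l, t⟩ ⟨hp, hpe⟩ ⟨s', l', t'⟩ ⟨hp', hpe'⟩ h
  have hpos (i : Fin 3) : 0 < s i := lt_of_le_of_ne (hp.1 i) fun h0 => hpe ⟨hp, i, h0.symm⟩
  have hpos' (i : Fin 3) : 0 < s' i := lt_of_le_of_ne (hp'.1 i) fun h0 => hpe' ⟨hp', i, h0.symm⟩
  obtain ⟨-, hl, ht, hsum⟩ := hp
  obtain ⟨-, hl', ht', hsum'⟩ := hp'
  rw [Fin.sum_univ_three] at hsum hsum'
  have hent (i j : Fin 3) := congrFun₂ h i j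
  obtain rfl : s = s' := by
    ext i
    refine (pow_left_inj₀ (hpos i).le (hpos' i).le two_ne_zero).mp ?_
    have := hent i i
    fin_cases i <;> simpa [copParam] using this
  have e₃ := hent 0 1
  have e₂ := hent 0 2
  have e₁ := hent 1 2
  simp only [copParam, Matrix.of_apply, Matrix.cons_val, sub_left_inj] at e₁ e₂ e₃
  simp only at hl hl' ht ht' hsum hsum'
  have p0 := hpos 0
  have p1 := hpos 1
  have p2 := hpos 2
  have q₃ : 0 < 2 * s 0 * s 1 := by positivity
  have q₂ : 0 < 2 * s 0 * s 2 := by positivity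
  have q₁ : 0 < 2 * s 1 * s 2 := by positivity
  obtain rfl : l = l' := sineSum_div_unique q₁ q₂ q₃ hl hl'
    (copWeight_nonneg (ht 1) (ht 2) (ht 0) (by linarith))
    (copWeight_nonneg (ht 0) (ht 2) (ht 1) (by linarith))
    (copWeight_nonneg (ht 0) (ht 1) (ht 2) hsum)
    (copWeight_nonneg (ht' 1) (ht' 2) (ht' 0) (by linarith))
    (copWeight_nonneg (ht' 0) (ht' 2) (ht' 1) (by linarith))
    (copWeight_nonneg (ht' 0) (ht' 1) (ht' 2) hsum')
    (sineSum_copWeight (ht 0) (ht 1) (ht 2) hsum)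
    (sineSum_copWeight (ht' 0) (ht' 1) (ht' 2) hsum') e₁ e₂ e₃ rfl rfl rfl
  obtain ⟨h0, h1, h2⟩ := eq_of_copWeight_eq (ht 0) (ht 1) (ht 2) hsum (ht' 0) (ht' 1) (ht' 2) hsum'
    (mul_left_cancel₀ (by linarith) e₁) (mul_left_cancel₀ (by linarith) e₂)
    (mul_left_cancel₀ (by linarith) e₃)
  obtain rfl : t = t' := by
    ext i
    fin_cases i <;> assumption
  rfl

/-! ### The exceptional set -/

/-- An affine parametrization, by a five-dimensional space, of a set that contains the part of the
domain where `sᵢ = 0`: the remaining two `s`-coordinates, `λ`, and `t₁, t₂`. -/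
noncomputable def faceChart (i : Fin 3) (v : (Fin 2 → ℝ) × ℝ × (Fin 2 → ℝ)) : CopParam :=
  (i.insertNth (α := fun _ => ℝ) 0 v.1, v.2.1, ![v.2.2 0, v.2.2 1, 1 - v.2.2 0 - v.2.2 1])

theorem contDiff_faceChart (i : Fin 3) : ContDiff ℝ 1 (faceChart i) := by
  refine .prodMk (contDiff_pi.mpr ?_) (.prodMk (by fun_prop) (contDiff_pi.mpr ?_))
  · rw [Fin.forall_iff_succAbove i]
    simp only [Fin.insertNth_apply_same, Fin.insertNth_apply_succAbove]
    exact ⟨contDiff_const, fun j => by fun_prop⟩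
  · simp only [Fin.forall_fin_succ]
    refine ⟨?_, ?_, ?_, by simp⟩ <;> simp <;> fun_prop

theorem copExceptional_subset : copExceptional ⊆ ⋃ i, Set.range (faceChart i) := by
  rintro ⟨s, l, t⟩ ⟨⟨-, -, -, hsum⟩, i, hi⟩
  refine Set.mem_iUnion.mpr ⟨i, (i.removeNth s, l, ![t 0, t 1]), ?_⟩
  rw [Fin.sum_univ_three] at hsum
  simp only at hi hsum
  refine Prod.ext ?_ (Prod.ext rfl ?_)
  · simp only [faceChart, ← hi]
    exact Fin.insertNth_self_removeNth i s
  · ext j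
    fin_cases j <;> simp [faceChart]
    linarith

theorem hausdorffMeasure_copExceptional :
    MeasureTheory.Measure.hausdorffMeasure 6 copExceptional = 0 := by
  refine MeasureTheory.measure_mono_null copExceptional_subset
    (MeasureTheory.measure_iUnion_null fun i => ?_)
  have hdim : dimH (Set.range (faceChart i)) ≤ 5 := by
    simpa [show (2 + (1 + 2) : ENNReal) = 5 by norm_num] using (contDiff_faceChart i).dimH_range_le
  refine hausdorffMeasure_of_dimH_lt (d := 6) (hdim.trans_lt ?_)
  norm_num

/-- `Φ` maps `ℝ⁴_{≥0} × Δ₃` into and onto the cone of copositive `3 × 3` matrices, and it is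
injective off the set where some `sᵢ` vanishes, which is a null set for the natural
(6-dimensional Hausdorff) measure of the 6-dimensional domain. -/
theorem mainTheorem1 :
    Set.MapsTo copParam copDomain (copositiveCone 3) ∧
    Set.SurjOn copParam copDomain (copositiveCone 3) ∧
    Set.InjOn copParam (copDomain \ copExceptional) ∧
    MeasureTheory.Measure.hausdorffMeasure 6 copExceptional = 0 :=
  ⟨mapsTo_copParam, surjOn_copParam, injOn_copParam, hausdorffMeasure_copExceptional⟩
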